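/- Let $q$ be a prime power and let $\mathrm{PG}(N-1,q)$ be the projective space whose points are the one-dimensional subspaces of $\mathbb{F}_q^N$ and whose hyperplanes are the $(N-1)$-dimensional subspaces of $\mathbb{F}_q^N$. A *projective $(n,N,h_1,h_2)$ set* is a proper, non-empty set $O$ of $n$ points of $\mathrm{PG}(N-1,q)$ such that each hyperplane contains either $h_1$ or $h_2$ points of $O$. Let $m$ and $\ell$ be positive integers and let $0\le r\le m$. Then the numbers below are non-negative integers, and the following exist. (1) A projective $(n_r,\,m(2\ell+1),\,h_{r,1},\,h_{r,2})$ set in $\mathrm{PG}(m(2\ell+1)-1,q)$, where $$n_r=\frac{(q^r-1)(q^{m\ell}-1)(q^{m(\ell+1)}-1)}{(q-1)(q^m-1)}+\frac{q^{m\ell}-1}{q-1},$$ $$h_{r,1}=\frac{(q^{m\ell-1}-1)(q^{m(\ell+1)+r}-q^{m(\ell+1)}+q^m-q^r)}{(q-1)(q^m-1)},$$ $$h_{r,2}=\frac{(q^{m\ell}-1)(q^{m(\ell+1)+r-1}-q^{m(\ell+1)-1}+q^m-q^r)}{(q-1)(q^m-1)}.$$ For $\ell=r=1$ these are the parameters of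 De Winter's projective sets: $$n_1=\frac{(q^m-1)(q^{m+1}-q^m+q)}{q-1},\quad h_{1,1}=\frac{q^{2m}-q^{2m-1}-q^{m+1}+2q^m-q}{q-1},\quad h_{1,2}=\frac{q^{2m}-q^{2m-1}+q^m-q}{q-1}.$$ (2) A projective $(n_r^+,\,m(2\ell+1),\,h_{r,1}^+,\,h_{r,2}^+)$ set in $\mathrm{PG}(m(2\ell+1)-1,q)$, where $$n_r^+=\frac{(q^m-q^{m-r})(q^{m\ell}-1)(q^{m(\ell+1)}-1)}{(q-1)(q^m-1)}+\frac{q^{m(\ell+1)}-1}{q-1},$$ $$h_{r,1}^+=\frac{(q^{m(\ell+1)-1}-1)(q^{m(\ell+1)}-q^{m(\ell+1)-r}+q^{m-r}-1)}{(q-1)(q^m-1)},$$ $$h_{r,2}^+=\frac{(q^{m(\ell+1)}-1)(q^{m(\ell+1)-1}-q^{m(\ell+1)-r-1}+q^{m-r}-1)}{(q-1)(q^m-1)}.$$ -/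

import Mathlib

/-- A projective `(n, N, h₁, h₂)` set: a proper, non-empty set `O` of `n` points of the projective
space `PG(N - 1, K)` (the one-dimensional subspaces of `K ^ N`) over the finite field `K`, such that
each hyperplane (each `(N - 1)`-dimensional subspace `H` of `K ^ N`) contains either `h₁` or `h₂`
points of `O`. -/
structure IsProjectiveSet (K : Type*) [Field K] [Finite K] (n N h₁ h₂ : ℕ)
    (O : Set (Projectivization K (Fin N → K))) : Prop where
  nonempty : O.Nonempty
  proper : O ≠ Set.univ
  card_eq : O.ncard = n
  hyperplane : ∀ H : Submodule K (Fin N → K), Module.finrank K H + 1 = N →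
    {P | P ∈ O ∧ P.submodule ≤ H}.ncard = h₁ ∨ {P | P ∈ O ∧ P.submodule ≤ H}.ncard = h₂

/-! Let F have degree m over K, let A and B have degrees ℓ and ℓ + 1 over F, and let R be a
K-subspace of F of dimension r. In A × B, of dimension m(2ℓ + 1) over K, take the pairs (a, b) with
a ≠ 0 and N(b)/N(a) ∈ R (`normCone`). A scalar u of K multiplies this ratio by u^(ℓ+1)/u^ℓ = u, so
the cone is a union of punctured lines, that is, a set of points.

The number of these points in the hyperplane dual to (α, β) is an affine function of the character
sum `coneSum`, so this sum has to take only two values. If α or β vanishes, it is computed directly,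
as all norm fibres over Fˣ have equal size. Otherwise rescaling reduces it to the sums of ψ(Tr b -
Tr a) over N(b)/N(a) = c. The Mellin transform of these at a multiplicative character θ is G_B(θ)
times the conjugate of G_A(θ), where G denotes Gauss sums. By Hasse–Davenport G_B = -G_A G_F, and
|G_A|² = |A| for θ ≠ 1, so the sum over the fibre of c is -|A| ψ(c) plus a constant
(`sum_sum_norm_div`). The group algebra ℂ[Fˣ] treats all θ at once. Summing over c in a multiple of
R leaves a character sum over an additive group, which is 0 or |R|. The two resulting values are
those of the degenerate cases (`coneSum_cases`).

The first family consists of these sets, the second of the complements of those with m - r in place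
of r. -/

/-! ### The Hasse–Davenport relation over a commutative ring -/

section HasseDavenport

open Polynomial UniqueFactorizationMonoid

variable {F Λ : Type*} [Field F] [CommRing Λ]

/-- The multiplicative function on monic polynomials built from the constant coefficient and the
coefficient next to the leading one. -/
noncomputable def polyChar (θ : F →*₀ Λ) (ψ : AddChar F Λ) (f : F[X]) : Λ :=
  θ ((-1) ^ f.natDegree * f.coeff 0) * ψ (-f.nextCoeff)

theorem polyChar_one (θ : F →*₀ Λ) (ψ : AddChar F Λ) : polyChar θ ψ 1 = 1 := by
  simp [polyChar, nextCoeff]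

theorem polyChar_mul (θ : F →*₀ Λ) (ψ : AddChar F Λ) {f g : F[X]} (hf : f.Monic) (hg : g.Monic) :
    polyChar θ ψ (f * g) = polyChar θ ψ f * polyChar θ ψ g := by
  simp only [polyChar, hf.natDegree_mul hg, hf.nextCoeff_mul hg, mul_coeff_zero, neg_add,
    AddChar.map_add_eq_mul, pow_add, map_mul]
  ring

theorem polyChar_pow (θ : F →*₀ Λ) (ψ : AddChar F Λ) {f : F[X]} (hf : f.Monic) (k : ℕ) :
    polyChar θ ψ (f ^ k) = polyChar θ ψ f ^ k := by
  induction k with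
  | zero => simp [polyChar_one]
  | succ k ih => rw [pow_succ, polyChar_mul θ ψ (hf.pow k) hf, ih, pow_succ]

theorem polyChar_X_sub_C (θ : F →*₀ Λ) (ψ : AddChar F Λ) (c : F) :
    polyChar θ ψ (X - C c) = θ c * ψ c := by
  simp [polyChar]

/-- Norm and trace of x from E are the power and the multiple, by [E : F(x)], of those from F(x),
and the latter are coefficients of the minimal polynomial up to sign. -/
theorem norm_mul_trace_eq_polyChar (E : Type*) [Field E] [Algebra F E] [FiniteDimensional F E]
    (θ : F →*₀ Λ) (ψ : AddChar F Λ) (x : E) :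
    θ (Algebra.norm F x) * ψ (Algebra.trace F E x) =
      polyChar θ ψ (minpoly F x) ^ Module.finrank (IntermediateField.adjoin F {x}) E := by
  have hx : IsIntegral F x := .of_finite F x
  have h1 := Algebra.PowerBasis.norm_gen_eq_coeff_zero_minpoly
    (IntermediateField.adjoin.powerBasis hx)
  have h2 := trace_adjoinSimpleGen hx
  rw [IntermediateField.adjoin.powerBasis_gen, IntermediateField.minpoly_gen,
    IntermediateField.adjoin.powerBasis_dim] at h1
  rw [Algebra.norm_eq_norm_adjoin, trace_eq_trace_adjoin, h1, h2, polyChar, map_pow, mul_pow,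
    AddChar.map_nsmul_eq_pow]

variable [Finite F]

variable (F) in
theorem finite_monic_natDegree_eq (n : ℕ) : {f : F[X] | f.Monic ∧ f.natDegree = n}.Finite := by
  have : Finite (degreeLT F (n + 1)) := .of_equiv _ (degreeLTEquiv F (n + 1)).symm.toEquiv
  refine (Set.toFinite (degreeLT F (n + 1) : Set F[X])).subset fun f hf ↦ ?_
  rw [SetLike.mem_coe, mem_degreeLT]
  exact (natDegree_lt_iff_degree_lt hf.1.ne_zero).1 (hf.2 ▸ Nat.lt_succ_self _)

variable (F) in
/-- The monic polynomials of degree `n` over a finite field. -/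
noncomputable def monicsOfDegree (n : ℕ) : Finset F[X] := (finite_monic_natDegree_eq F n).toFinset

theorem mem_monicsOfDegree {n : ℕ} {f : F[X]} :
    f ∈ monicsOfDegree F n ↔ f.Monic ∧ f.natDegree = n := by
  simp [monicsOfDegree]

open Classical in
variable (F) in
/-- The monic irreducible polynomials of degree at most `n` over a finite field. -/
noncomputable def irreduciblesUpTo (n : ℕ) : Finset F[X] :=
  ((Finset.range (n + 1)).biUnion (monicsOfDegree F)).filter Irreducible

theorem mem_irreduciblesUpTo {n : ℕ} {f : F[X]} :
    f ∈ irreduciblesUpTo F n ↔ f.Monic ∧ Irreducible f ∧ f.natDegree ≤ n := by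
  simp [irreduciblesUpTo, mem_monicsOfDegree]
  grind

theorem monicsOfDegree_zero : monicsOfDegree F 0 = {1} := by
  ext f
  rw [mem_monicsOfDegree, Finset.mem_singleton]
  exact ⟨fun h ↦ h.1.natDegree_eq_zero.1 h.2, fun h ↦ by simp [h]⟩

theorem sum_monicsOfDegree_one [Fintype F] (θ : F →*₀ Λ) (ψ : AddChar F Λ) :
    ∑ f ∈ monicsOfDegree F 1, polyChar θ ψ f = ∑ c, θ c * ψ c := by
  symm
  refine Finset.sum_bij (fun c _ ↦ X - C c) (fun c _ ↦ mem_monicsOfDegree.2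
    ⟨monic_X_sub_C c, natDegree_X_sub_C c⟩) (fun a _ b _ h ↦ by simpa using h) (fun f hf ↦ ?_)
    fun c _ ↦ (polyChar_X_sub_C θ ψ c).symm
  obtain ⟨hf, hd⟩ := mem_monicsOfDegree.1 hf
  refine ⟨-f.coeff 0, Finset.mem_univ _, ?_⟩
  conv_rhs => rw [hf.eq_X_add_C hd]
  simp

/-- Adding c X^(n-1) permutes the monic polynomials of degree n. For n ≥ 2 it leaves the constant
coefficient alone, so only the factor ψ changes and the sum equals ψ(c) times itself. As Λ may have
zero divisors, 1 - ψ(c) is required to be a unit. -/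
theorem sum_monicsOfDegree_eq_zero (θ : F →*₀ Λ) (ψ : AddChar F Λ)
    (hψ : ∃ c, IsUnit (1 - ψ c)) {n : ℕ} (hn : 2 ≤ n) :
    ∑ f ∈ monicsOfDegree F n, polyChar θ ψ f = 0 := by
  obtain ⟨c, hc⟩ := hψ
  have hlt (d : F) : (C d * X ^ (n - 1)).degree < (n : WithBot ℕ) :=
    (degree_C_mul_X_pow_le _ _).trans_lt (by exact_mod_cast (by omega : n - 1 < n))
  have key {f : F[X]} (hf : f ∈ monicsOfDegree F n) (d : F) :
      (f + C d * X ^ (n - 1)).Monic ∧ (f + C d * X ^ (n - 1)).natDegree = n := by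
    obtain ⟨hf, hd⟩ := mem_monicsOfDegree.1 hf
    have h : (C d * X ^ (n - 1)).degree < f.degree := by
      rw [degree_eq_natDegree hf.ne_zero, hd]; exact hlt d
    exact ⟨hf.add_of_left h, (natDegree_add_eq_left_of_degree_lt h).trans hd⟩
  have h : ∑ f ∈ monicsOfDegree F n, polyChar θ ψ f =
      ∑ f ∈ monicsOfDegree F n, ψ c * polyChar θ ψ f := by
    refine Finset.sum_bij' (fun f _ ↦ f + C c * X ^ (n - 1)) (fun f _ ↦ f + C (-c) * X ^ (n - 1))
      (fun f hf ↦ mem_monicsOfDegree.2 (key hf c)) (fun f hf ↦ mem_monicsOfDegree.2 (key hf (-c)))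
      (fun f _ ↦ by simp) (fun f _ ↦ by simp) fun f hf ↦ ?_
    obtain ⟨h1, h2⟩ := key hf c
    obtain ⟨hf, hd⟩ := mem_monicsOfDegree.1 hf
    rw [polyChar, polyChar, h2, hd, nextCoeff_of_natDegree_pos (by omega),
      nextCoeff_of_natDegree_pos (by omega), h2, hd, coeff_add, coeff_add, coeff_C_mul_X_pow,
      coeff_C_mul_X_pow, if_neg (by omega), if_pos rfl, add_zero, mul_left_comm,
      ← AddChar.map_add_eq_mul]
    congr 2
    ring
  rw [← Finset.mul_sum] at h
  have h' : (1 - ψ c) * ∑ f ∈ monicsOfDegree F n, polyChar θ ψ f = 0 := by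
    rw [sub_mul, one_mul, ← h, sub_self]
  exact hc.mul_right_eq_zero.1 h'

open Classical in
/-- The degree of a polynomial, counted through the prime powers dividing it. -/
theorem natDegree_eq_sum_irreducibles {f : F[X]} (hf : f.Monic) {n : ℕ} (hd : f.natDegree = n) :
    (n : Λ) = ∑ P ∈ irreduciblesUpTo F n, ∑ j ∈ Finset.Icc 1 n,
      if P ^ j ∣ f then (P.natDegree : Λ) else 0 := by
  have hf0 := hf.ne_zero
  have hmem {P : F[X]} (hP : P ∈ normalizedFactors f) : P ∈ irreduciblesUpTo F n := by
    have hdvd := dvd_of_mem_normalizedFactors hP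
    refine mem_irreduciblesUpTo.2 ⟨?_, irreducible_of_normalized_factor _ hP,
      hd ▸ natDegree_le_of_dvd hdvd hf0⟩
    rw [← normalize_normalized_factor _ hP]
    exact monic_normalize (ne_zero_of_mem_normalizedFactors hP)
  have hdeg : n = ∑ P ∈ irreduciblesUpTo F n, (normalizedFactors f).count P * P.natDegree := by
    have h : (normalizedFactors f).prod = f := by
      rw [prod_normalizedFactors_eq hf0, hf.normalize_eq_self]
    rw [← hd]
    conv_lhs => rw [← h, natDegree_multiset_prod _ (zero_notMem_normalizedFactors f)]
    rw [hd, Finset.sum_multiset_map_count]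
    refine Finset.sum_subset (fun P hP ↦ hmem (Multiset.mem_toFinset.1 hP)) fun P _ hP ↦ ?_
    rw [Multiset.count_eq_zero_of_notMem fun h ↦ hP (Multiset.mem_toFinset.2 h), zero_smul]
  conv_lhs => rw [hdeg]
  rw [Nat.cast_sum]
  refine Finset.sum_congr rfl fun P hP ↦ ?_
  obtain ⟨hPm, hPi, hPd⟩ := mem_irreduciblesUpTo.1 hP
  -- The multiplicity of P in f is the number of j ≥ 1 with P ^ j ∣ f.
  have hiff (j : ℕ) : P ^ j ∣ f ↔ j ≤ (normalizedFactors f).count P := by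
    rw [dvd_iff_normalizedFactors_le_normalizedFactors (pow_ne_zero _ hPi.ne_zero) hf0,
      hPi.normalizedFactors_pow, hPm.normalize_eq_self, Multiset.le_count_iff_replicate_le]
  have hle : (normalizedFactors f).count P ≤ n := by
    have h := natDegree_le_of_dvd ((hiff _).2 le_rfl) hf0
    rw [natDegree_pow, hd] at h
    exact (Nat.le_mul_of_pos_right _ hPi.natDegree_pos).trans h
  simp_rw [hiff]
  rw [← Finset.sum_filter, Finset.sum_const, nsmul_eq_mul, Nat.cast_mul]
  congr 2
  have : {a ∈ Finset.Icc 1 n | a ≤ (normalizedFactors f).count P} =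
      Finset.Icc 1 ((normalizedFactors f).count P) := by
    ext a; simp; omega
  simp [this]

open Classical in
theorem sum_monicsOfDegree_dvd (θ : F →*₀ Λ) (ψ : AddChar F Λ) {P : F[X]} (hP : P.Monic) (n : ℕ) :
    (∑ f ∈ monicsOfDegree F n, if P ∣ f then polyChar θ ψ f else 0) =
      if P.natDegree ≤ n then
        polyChar θ ψ P * ∑ g ∈ monicsOfDegree F (n - P.natDegree), polyChar θ ψ g else 0 := by
  rw [← Finset.sum_filter]
  split_ifs with h
  · rw [Finset.mul_sum]
    symm
    refine Finset.sum_bij (fun g _ ↦ P * g) (fun g hg ↦ ?_) (fun a _ b _ h ↦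
      mul_left_cancel₀ hP.ne_zero h) (fun f hf ↦ ?_) fun g hg ↦
      (polyChar_mul θ ψ hP (mem_monicsOfDegree.1 hg).1).symm
    · obtain ⟨h1, h2⟩ := mem_monicsOfDegree.1 hg
      exact Finset.mem_filter.2 ⟨mem_monicsOfDegree.2 ⟨hP.mul h1,
        by rw [hP.natDegree_mul h1]; omega⟩, dvd_mul_right _ _⟩
    · obtain ⟨hf, g, rfl⟩ := Finset.mem_filter.1 hf
      obtain ⟨h1, h2⟩ := mem_monicsOfDegree.1 hf
      have hg := hP.of_mul_monic_left h1
      rw [hP.natDegree_mul hg] at h2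
      exact ⟨g, mem_monicsOfDegree.2 ⟨hg, by omega⟩, rfl⟩
  · refine Finset.sum_eq_zero fun f hf ↦ ?_
    obtain ⟨hf, hd⟩ := Finset.mem_filter.1 hf
    obtain ⟨h1, h2⟩ := mem_monicsOfDegree.1 hf
    exact absurd (h2 ▸ natDegree_le_of_dvd hd h1.ne_zero) h

/-- The sum over the prime powers `P ^ j` of degree `k`, weighted by the degree of `P`, where `n`
bounds the primes and exponents used. -/
noncomputable def primePowerSum (θ : F →*₀ Λ) (ψ : AddChar F Λ) (n k : ℕ) : Λ :=
  ∑ P ∈ irreduciblesUpTo F n, ∑ j ∈ Finset.Icc 1 n,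
    if j * P.natDegree = k then (P.natDegree : Λ) * polyChar θ ψ P ^ j else 0

/-- The L-function of `polyChar` is L = 1 + g t with g = ∑ θ(c) ψ(c), and the prime power sums are
the coefficients of t L'/L. This is the coefficient of t^(n+1) in (t L'/L) · L = t L', obtained
without power series by weighting each f with its degree and exchanging sums. -/
theorem primePowerSum_add_eq_zero [Fintype F] (θ : F →*₀ Λ) (ψ : AddChar F Λ)
    (hψ : ∃ c, IsUnit (1 - ψ c)) {n : ℕ} (hn : 1 ≤ n) :
    primePowerSum θ ψ (n + 1) (n + 1) + primePowerSum θ ψ (n + 1) n * ∑ c, θ c * ψ c = 0 := by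
  classical
  have h0 : ∑ f ∈ monicsOfDegree F (n + 1), ∑ P ∈ irreduciblesUpTo F (n + 1),
      ∑ j ∈ Finset.Icc 1 (n + 1),
        (if P ^ j ∣ f then (P.natDegree : Λ) else 0) * polyChar θ ψ f = 0 := by
    trans ((n + 1 : ℕ) : Λ) * ∑ f ∈ monicsOfDegree F (n + 1), polyChar θ ψ f
    swap
    · rw [sum_monicsOfDegree_eq_zero θ ψ hψ (by omega), mul_zero]
    rw [Finset.mul_sum]
    refine Finset.sum_congr rfl fun f hf ↦ ?_
    obtain ⟨h1, h2⟩ := mem_monicsOfDegree.1 hf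
    conv_rhs => rw [natDegree_eq_sum_irreducibles (Λ := Λ) h1 h2, Finset.sum_mul]
    exact Finset.sum_congr rfl fun P _ ↦ (Finset.sum_mul _ _ _).symm
  rw [← h0, primePowerSum, primePowerSum, Finset.sum_mul, ← Finset.sum_add_distrib,
    Finset.sum_comm]
  refine Finset.sum_congr rfl fun P hP ↦ ?_
  obtain ⟨hPm, hPi, hPd⟩ := mem_irreduciblesUpTo.1 hP
  simp_rw [Finset.sum_mul]
  rw [Finset.sum_comm, ← Finset.sum_add_distrib]
  refine Finset.sum_congr rfl fun j hj ↦ ?_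
  have h1 : ∑ f ∈ monicsOfDegree F (n + 1),
      (if P ^ j ∣ f then (P.natDegree : Λ) else 0) * polyChar θ ψ f =
      P.natDegree * ∑ f ∈ monicsOfDegree F (n + 1), if P ^ j ∣ f then polyChar θ ψ f else 0 := by
    rw [Finset.mul_sum]
    exact Finset.sum_congr rfl fun f _ ↦ by split_ifs <;> simp
  rw [h1, sum_monicsOfDegree_dvd θ ψ (hPm.pow j), polyChar_pow θ ψ hPm, natDegree_pow]
  -- The cofactor of P ^ j has degree n + 1 - j deg P. Its sum vanishes in degree at least 2, so
  -- only degrees 1 and 0 survive.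
  rcases lt_trichotomy (j * P.natDegree) n with h | h | h
  · rw [if_neg (by omega), if_neg (by omega), if_pos (by omega),
      sum_monicsOfDegree_eq_zero θ ψ hψ (by omega)]
    simp
  · rw [if_neg (by omega), if_pos h, if_pos (by omega), h, Nat.add_sub_cancel_left,
      sum_monicsOfDegree_one]
    ring
  · rcases eq_or_lt_of_le (Nat.succ_le_of_lt h) with h | h
    · rw [if_pos (by omega), if_neg (by omega), if_pos (by omega), ← h, Nat.succ_eq_add_one,
        Nat.sub_self, monicsOfDegree_zero]
      simp [polyChar_one]
    · rw [if_neg (by omega), if_neg (by omega), if_neg (by omega)]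
      simp

theorem card_minpoly_eq (E : Type*) [Field E] [Algebra F E] [Finite E] {P : F[X]} (hP : P.Monic)
    (hi : Irreducible P) (hd : P.natDegree ∣ Module.finrank F E) :
    Nat.card {x : E // minpoly F x = P} = P.natDegree := by
  have := Fintype.ofFinite E
  have hdvd : P ∣ X ^ Nat.card E - X := by
    rw [Module.natCard_eq_pow_finrank (K := F)]
    exact hi.natDegree_dvd_iff_dvd_X_pow_card_pow_sub_X.1 hd
  have hs : (P.map (algebraMap F E)).Splits := by
    refine Splits.of_dvd (FiniteField.isSplittingField_sub E F).splits
      (map_ne_zero (FiniteField.X_pow_card_sub_X_ne_zero F (Fintype.one_lt_card (α := E)))) ?_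
    rw [← Nat.card_eq_fintype_card]
    exact Polynomial.map_dvd (algebraMap F E) hdvd
  have hsep : P.Separable := PerfectField.separable_of_irreducible hi
  rw [← card_rootSet_eq_natDegree hsep hs, ← Nat.card_eq_fintype_card]
  refine Nat.card_congr (Equiv.subtypeEquivRight fun x ↦ ?_)
  rw [mem_rootSet_of_ne hi.ne_zero]
  exact ⟨fun h ↦ h ▸ minpoly.aeval F x, fun h ↦ (minpoly.eq_of_irreducible_of_monic hi h hP).symm⟩

/-- Group the elements of E by minimal polynomial: each P whose degree divides [E : F] has deg P
roots in E, and each root contributes the same power of `polyChar θ ψ P`. -/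
theorem sum_norm_trace_eq_primePowerSum (E : Type*) [Field E] [Algebra F E] [Fintype E]
    (θ : F →*₀ Λ) (ψ : AddChar F Λ) {n : ℕ} (hn : Module.finrank F E ≤ n) :
    ∑ x : E, θ (Algebra.norm F x) * ψ (Algebra.trace F E x) =
      primePowerSum θ ψ n (Module.finrank F E) := by
  classical
  have hdeg (x : E) : Module.finrank (IntermediateField.adjoin F {x}) E * (minpoly F x).natDegree
      = Module.finrank F E := by
    rw [← IntermediateField.adjoin.finrank (.of_finite F x), mul_comm, Module.finrank_mul_finrank]
  rw [primePowerSum, ← Finset.sum_fiberwise_of_maps_to (g := fun x : E ↦ minpoly F x)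
    (t := irreduciblesUpTo F n)]
  · refine Finset.sum_congr rfl fun P hP ↦ ?_
    obtain ⟨hPm, hPi, hPd⟩ := mem_irreduciblesUpTo.1 hP
    by_cases hd : P.natDegree ∣ Module.finrank F E
    · obtain ⟨k, hk⟩ := hd
      have hk0 : 0 < Module.finrank F E := Module.finrank_pos
      have hkpos : 0 < k := Nat.pos_of_ne_zero (by rintro rfl; omega)
      have hkn : k ≤ n := (Nat.le_mul_of_pos_left _ hPi.natDegree_pos).trans (hk ▸ hn)
      -- Only the exponent k = [E : F] / deg P, which is [E : F(x)] for each root x of P, meets the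
      -- degree condition.
      rw [Finset.sum_eq_single_of_mem k (Finset.mem_Icc.2 ⟨hkpos, hkn⟩),
        if_pos (by rw [hk, mul_comm])]
      · rw [Finset.sum_congr rfl (g := fun _ ↦ polyChar θ ψ P ^ k), Finset.sum_const, nsmul_eq_mul]
        · congr 2
          rw [← card_minpoly_eq E hPm hPi ⟨k, hk⟩, Nat.card_eq_fintype_card, Fintype.card_subtype]
        · intro x hx
          obtain rfl : minpoly F x = P := (Finset.mem_filter.1 hx).2
          rw [norm_mul_trace_eq_polyChar]
          congr 1
          have := hdeg x
          rw [hk, mul_comm] at this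
          exact Nat.eq_of_mul_eq_mul_left hPi.natDegree_pos this
      · intro j _ hj
        rw [if_neg]
        intro h
        rw [hk, mul_comm] at h
        exact hj (Nat.eq_of_mul_eq_mul_left hPi.natDegree_pos h)
    · rw [Finset.filter_eq_empty_iff.2, Finset.sum_empty, Finset.sum_eq_zero]
      · intro j _
        rw [if_neg]
        rintro h
        exact hd ⟨j, by rw [← h, mul_comm]⟩
      · rintro x - rfl
        exact hd ⟨_, by rw [mul_comm, hdeg]⟩
  · intro x _
    have hx : IsIntegral F x := .of_finite F x
    refine mem_irreduciblesUpTo.2 ⟨minpoly.monic hx, minpoly.irreducible hx, le_trans ?_ hn⟩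
    rw [← hdeg x]
    exact Nat.le_mul_of_pos_left _ Module.finrank_pos

/-- The Hasse–Davenport relation, as a recursion on the degree of the extension. -/
theorem sum_norm_trace_succ [Fintype F] (E E' : Type*) [Field E] [Algebra F E] [Fintype E]
    [Field E'] [Algebra F E'] [Fintype E'] (θ : F →*₀ Λ) (ψ : AddChar F Λ)
    (hψ : ∃ c, IsUnit (1 - ψ c)) (h : Module.finrank F E' = Module.finrank F E + 1) :
    ∑ x : E', θ (Algebra.norm F x) * ψ (Algebra.trace F E' x) =
      -((∑ x : E, θ (Algebra.norm F x) * ψ (Algebra.trace F E x)) * ∑ c, θ c * ψ c) := by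
  rw [sum_norm_trace_eq_primePowerSum E' θ ψ h.le, sum_norm_trace_eq_primePowerSum E θ ψ
    (Nat.le_succ _), h, eq_neg_iff_add_eq_zero]
  exact primePowerSum_add_eq_zero θ ψ hψ Module.finrank_pos

end HasseDavenport

/-! ### Gauss sums in the group algebra and the distribution of norm ratios -/

section NormRatio

open scoped Classical

theorem MonoidHom.sum_comp_of_surjective {G H M : Type*} [Group G] [Group H] [Fintype G] [Fintype H]
    [AddCommMonoid M] (f : G →* H) (hf : Function.Surjective f) (g : H → M) :
    ∑ x, g (f x) = Nat.card f.ker • ∑ y, g y := by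
  rw [← Finset.sum_fiberwise _ f, Finset.smul_sum]
  refine Finset.sum_congr rfl fun y _ ↦ ?_
  rw [Finset.sum_congr rfl fun x hx ↦ by rw [(Finset.mem_filter.1 hx).2], Finset.sum_const]
  congr 1
  rw [MonoidHom.card_fiber_eq_of_mem_range f (hf y) (hf 1), ← Fintype.card_subtype,
    ← Nat.card_eq_fintype_card]
  rfl

variable {F : Type*} [Field F]

/-- The universal multiplicative character of a field, with values in a group algebra. -/
noncomputable def universalChar (F : Type*) [Field F] : F →*₀ MonoidAlgebra ℂ Fˣ where
  toFun x := if h : x = 0 then 0 else .single (Units.mk0 x h) 1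
  map_zero' := by simp
  map_one' := by simp [MonoidAlgebra.one_def]
  map_mul' x y := by
    by_cases hx : x = 0
    · simp [hx]
    by_cases hy : y = 0
    · simp [hy]
    simp [hx, hy, MonoidAlgebra.single_mul_single]

theorem universalChar_unit (u : Fˣ) : universalChar F u = .single u 1 := by
  simp [universalChar]

theorem sum_universalChar {ι : Type*} [Field ι] [Fintype ι] (f : ι →*₀ F) (g : ι → ℂ) :
    ∑ x, universalChar F (f x) * algebraMap ℂ (MonoidAlgebra ℂ Fˣ) (g x) =
      ∑ x : ιˣ, MonoidAlgebra.single (Units.map (f : ι →* F) x) (g x) := by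
  rw [← Finset.sum_erase (a := 0) _ (by simp)]
  symm
  refine Finset.sum_bij (fun x _ ↦ (x : ι)) (by simp) (fun _ _ _ _ h ↦ Units.ext h)
    (fun x hx ↦ ⟨Units.mk0 x (by simpa using hx), by simp⟩) fun x _ ↦ ?_
  have : f x = (Units.map (f : ι →* F) x : Fˣ) := rfl
  rw [this, universalChar_unit]
  simp [MonoidAlgebra.single_mul_single]

theorem sum_units_eq {E : Type*} [Field E] [Fintype E] {M : Type*} [AddCommGroup M] (g : E → M) :
    ∑ x : Eˣ, g x = (∑ x, g x) - g 0 := by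
  rw [eq_sub_iff_add_eq, ← Finset.sum_erase_add _ _ (Finset.mem_univ (0 : E))]
  congr 1
  exact Finset.sum_bij (fun x _ ↦ (x : E)) (by simp) (fun _ _ _ _ h ↦ Units.ext h)
    (fun x hx ↦ ⟨Units.mk0 x (by simpa using hx), by simp⟩) fun x _ ↦ rfl

theorem AddChar.sum_units_mulShift {E : Type*} [Field E] [Fintype E]
    {χ : AddChar E ℂ} (hχ : χ ≠ 1) (w : E) :
    ∑ x : Eˣ, χ (x * w) = (if w = 0 then (Fintype.card E : ℂ) else 0) - 1 := by
  rw [sum_units_eq (fun x ↦ χ (x * w)), AddChar.sum_mulShift w (.of_ne_one hχ)]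
  simp

open MonoidAlgebra

variable [Fintype F] {E : Type*} [Field E] [Algebra F E] [Fintype E]

/-- The norm on unit groups. -/
noncomputable abbrev unitsNorm (F E : Type*) [Field F] [Field E] [Algebra F E] : Eˣ →* Fˣ :=
  Units.map (Algebra.norm F (S := E))

/-- The composite of an additive character and the trace. -/
noncomputable abbrev traceChar (E : Type*) [Field E] [Algebra F E] (ψ : AddChar F ℂ) :
    AddChar E ℂ :=
  ψ.compAddMonoidHom (Algebra.trace F E).toAddMonoidHom

omit [Fintype F] in
theorem traceChar_ne_one [Finite F] {ψ : AddChar F ℂ} (hψ : ψ ≠ 1) : traceChar E ψ ≠ 1 := by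
  obtain ⟨c, hc⟩ := AddChar.ne_one_iff.1 hψ
  obtain ⟨x, hx⟩ := Algebra.trace_surjective F E c
  exact AddChar.ne_one_iff.2 ⟨x, by simpa [hx] using hc⟩

/-- A Gauss sum in the group algebra, for the universal multiplicative character. -/
noncomputable def universalGaussSum (E : Type*) [Field E] [Algebra F E] [Fintype E]
    (ψ : AddChar F ℂ) : MonoidAlgebra ℂ Fˣ :=
  ∑ x : Eˣ, single (unitsNorm F E x) (traceChar E ψ x)

omit [Fintype F] in
theorem sum_universalChar_norm (ψ : AddChar F ℂ) :
    ∑ x : E, universalChar F (Algebra.norm F x) *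
      (algebraMap ℂ (MonoidAlgebra ℂ Fˣ) : ℂ →* _).compAddChar ψ (Algebra.trace F E x) =
      universalGaussSum E ψ :=
  have : FiniteDimensional F E := .of_finite
  sum_universalChar (⟨⟨Algebra.norm F, Algebra.norm_zero⟩, map_one _, map_mul _⟩ : E →*₀ F)
    (traceChar E ψ)

theorem universalGaussSum_succ {E' : Type*} [Field E'] [Algebra F E'] [Fintype E']
    {ψ : AddChar F ℂ} (hψ : ψ ≠ 1) (h : Module.finrank F E' = Module.finrank F E + 1) :
    universalGaussSum E' ψ = -(universalGaussSum E ψ * ∑ c : Fˣ, single c (ψ c)) := by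
  have key := sum_norm_trace_succ E E' (universalChar F)
    ((algebraMap ℂ (MonoidAlgebra ℂ Fˣ) : ℂ →* _).compAddChar ψ) (by
      obtain ⟨c, hc⟩ := AddChar.ne_one_iff.1 hψ
      refine ⟨c, ?_⟩
      -- A nonzero complex scalar stays a unit in the group algebra, although that algebra is not a
      -- domain in general.
      have := (sub_ne_zero.2 hc.symm).isUnit.map (algebraMap ℂ (MonoidAlgebra ℂ Fˣ))
      simpa [MonoidAlgebra.one_def] using this) h
  rw [sum_universalChar_norm, sum_universalChar_norm] at key
  rw [key]
  congr 2
  exact sum_universalChar (.id F) ψ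

/-- This is |G(θ)|² = |E| for all θ at once; the multiple of the sum of all group elements corrects
the trivial character. After the substitution z ↦ z x, the sum over x is a complete character sum
less its term at 0. -/
theorem universalGaussSum_mul_inv {ψ : AddChar F ℂ} (hψ : ψ ≠ 1) :
    universalGaussSum E ψ * ∑ x : Eˣ, single (unitsNorm F E x)⁻¹ (traceChar E ψ (-x)) =
      single 1 (Fintype.card E : ℂ) - Nat.card (unitsNorm F E).ker • ∑ u : Fˣ, single u 1 := by
  rw [← MonoidHom.sum_comp_of_surjective _ (FiniteField.unitsMap_norm_surjective F E),
    universalGaussSum, Finset.mul_sum]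
  have h1 (x : Eˣ) : (∑ z : Eˣ, single (unitsNorm F E z) (traceChar E ψ z)) *
      single (unitsNorm F E x)⁻¹ (traceChar E ψ (-x)) =
      ∑ z : Eˣ, single (unitsNorm F E z) (traceChar E ψ (x * (z - 1))) := by
    rw [Finset.sum_mul, ← Equiv.sum_comp (Equiv.mulRight x)]
    refine Finset.sum_congr rfl fun z _ ↦ ?_
    rw [single_mul_single, ← AddChar.map_add_eq_mul]
    congr 1
    · simp
    · congr 1
      simp
      ring
  simp_rw [h1]
  rw [Finset.sum_comm]
  have h2 (z : Eˣ) : ∑ x : Eˣ, single (unitsNorm F E z) (traceChar E ψ (x * (z - 1))) =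
      (if z = 1 then single 1 (Fintype.card E : ℂ) else 0) - single (unitsNorm F E z) 1 := by
    have h3 := AddChar.sum_units_mulShift (traceChar_ne_one (E := E) hψ) ((z : E) - 1)
    have h4 := map_sum (singleAddHom (R := ℂ) (unitsNorm F E z))
      (fun x : Eˣ ↦ traceChar E ψ (x * (z - 1))) Finset.univ
    simp only [singleAddHom_apply] at h4
    rw [← h4, h3, single_sub]
    congr 1
    simp only [sub_eq_zero, Units.val_eq_one]
    split_ifs with hz
    · simp [hz]
    · simp
  simp_rw [h2]
  rw [Finset.sum_sub_distrib]
  simp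

/-- The convolution of the norm fibres of two fields of consecutive degrees. -/
theorem sum_sum_norm_div {A B : Type*} [Field A] [Algebra F A] [Fintype A] [Field B] [Algebra F B]
    [Fintype B] {ψ : AddChar F ℂ} (hψ : ψ ≠ 1)
    (h : Module.finrank F B = Module.finrank F A + 1) (g : Fˣ → ℂ) :
    ∑ a : Aˣ, ∑ b : Bˣ, g (unitsNorm F B b * (unitsNorm F A a)⁻¹) *
      (traceChar A ψ (-a) * traceChar B ψ b) =
      -(Fintype.card A * ∑ c : Fˣ, g c * ψ c) -
        Nat.card (unitsNorm F A).ker * ∑ c : Fˣ, g c := by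
  have key : (universalGaussSum B ψ * ∑ x : Aˣ, single (unitsNorm F A x)⁻¹ (traceChar A ψ (-x))) =
      -(single 1 (Fintype.card A : ℂ) * ∑ c : Fˣ, single c (ψ c)) -
      (Nat.card (unitsNorm F A).ker : ℂ) • ∑ u : Fˣ, single u 1 := by
    rw [Nat.cast_smul_eq_nsmul, universalGaussSum_succ (E := A) hψ h, neg_mul, mul_right_comm,
      universalGaussSum_mul_inv hψ, sub_mul, neg_sub, smul_mul_assoc]
    -- The sum of all group elements absorbs each group element, and ψ sums to -1 over Fˣ.
    have : (∑ u : Fˣ, single u (1 : ℂ)) * ∑ c : Fˣ, single c (ψ c) = -∑ u : Fˣ, single u 1 := by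
      rw [Finset.mul_sum]
      have h1 (c : Fˣ) : (∑ u : Fˣ, single u (1 : ℂ)) * single c (ψ c) =
          ψ c • ∑ u : Fˣ, single u 1 := by
        rw [Finset.sum_mul, ← Equiv.sum_comp (Equiv.mulRight c) (fun u ↦ single u (1 : ℂ)),
          Finset.smul_sum]
        simp [single_mul_single]
      simp_rw [h1]
      rw [← Finset.sum_smul]
      have := AddChar.sum_units_mulShift hψ 1
      simp only [mul_one, one_ne_zero, if_false, zero_sub] at this
      rw [this, neg_smul, one_smul]
    rw [this]
    simp
    abel
  -- Apply the linear functional on the group algebra that sends each group element u to g(u).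
  have hL := congrArg (fun x : MonoidAlgebra ℂ Fˣ ↦
    Finsupp.linearCombination ℂ g (coeffLinearEquiv ℂ x)) key
  have hs (u : Fˣ) (z : ℂ) : Finsupp.linearCombination ℂ g (coeffLinearEquiv ℂ (single u z)) =
    z * g u := by
    simp
  simp only [universalGaussSum, Finset.mul_sum, Finset.sum_mul, single_mul_single, map_sum,
    map_sub, map_neg, map_smul, hs, one_mul, smul_eq_mul] at hL
  rw [← Finset.sum_congr rfl fun a _ ↦ Finset.sum_congr rfl fun b _ ↦ ?_, hL]
  · rw [Finset.mul_sum, Finset.mul_sum]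
    congr 2
    exact Finset.sum_congr rfl fun _ _ ↦ by ring
  · ring

end NormRatio

/-! ### Character sums over the norm cone -/

section ConeSum

open scoped Classical

variable {F : Type*} [Field F] [Fintype F]

theorem card_ker_unitsNorm (E : Type*) [Field E] [Algebra F E] [Fintype E] :
    (Nat.card (unitsNorm F E).ker : ℂ) * (Fintype.card F - 1) = Fintype.card E - 1 := by
  have h := MonoidHom.sum_comp_of_surjective _ (FiniteField.unitsMap_norm_surjective F E)
    fun _ ↦ (1 : ℂ)
  rw [sum_units_eq (E := E) fun _ ↦ (1 : ℂ), sum_units_eq (E := F) fun _ ↦ (1 : ℂ)] at h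
  simpa using h.symm

/-- The indicator function of an additive subgroup on the non-zero elements. -/
noncomputable def unitsIndicator (R : AddSubgroup F) (u : Fˣ) : ℂ := if (u : F) ∈ R then 1 else 0

theorem sum_unitsIndicator_mul_addChar (R : AddSubgroup F) (χ : AddChar F ℂ) :
    ∑ u : Fˣ, unitsIndicator R u * χ u = (∑ s : R, χ s) - 1 := by
  have h := sum_units_eq fun u : F ↦ (if u ∈ R then 1 else 0) * χ u
  simp only [R.zero_mem, if_true, AddChar.map_zero_eq_one, one_mul] at h
  rw [Finset.sum_congr rfl fun u _ ↦ by rw [unitsIndicator], h]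
  congr 1
  simp only [ite_mul, one_mul, zero_mul]
  rw [← Finset.sum_filter]
  exact Finset.sum_subtype _ (by simp) _

theorem sum_unitsIndicator (R : AddSubgroup F) :
    ∑ u : Fˣ, unitsIndicator R u = Nat.card R - 1 := by
  simpa using sum_unitsIndicator_mul_addChar R 0

/-- Moving w into the character leaves a character sum over the additive group R, which is 0 or |R|,
less its term at 0. -/
theorem sum_unitsIndicator_mul_addChar_cases (R : AddSubgroup F) (χ : AddChar F ℂ) (w : Fˣ) :
    ∑ u : Fˣ, unitsIndicator R (u * w) * χ u = -1 ∨
      ∑ u : Fˣ, unitsIndicator R (u * w) * χ u = Nat.card R - 1 := by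
  have h : ∑ u : Fˣ, unitsIndicator R (u * w) * χ u =
      ∑ u : Fˣ, unitsIndicator R u * (AddChar.mulShift χ ((w⁻¹ : Fˣ) : F)) u := by
    rw [← Equiv.sum_comp (Equiv.mulRight w⁻¹)]
    simp [mul_comm]
  rw [h, sum_unitsIndicator_mul_addChar]
  have h2 := AddChar.sum_eq_ite
    ((AddChar.mulShift χ ((w⁻¹ : Fˣ) : F)).compAddMonoidHom R.subtype)
  simp only [AddChar.compAddMonoidHom_apply, AddSubgroup.subtype_apply] at h2
  rw [h2]
  split_ifs <;> simp

variable {A B : Type*} [Field A] [Algebra F A] [Fintype A] [Field B] [Algebra F B] [Fintype B]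

/-- The cone of the pairs `(a, b)` such that `a ≠ 0` and the ratio of the norms of `b` and `a`
lies in `R`. -/
def normCone (R : AddSubgroup F) (A B : Type*) [Field A] [Algebra F A] [Field B] [Algebra F B] :
    Set (A × B) :=
  {v | v.1 ≠ 0 ∧ Algebra.norm F v.2 * (Algebra.norm F v.1)⁻¹ ∈ R}

/-- The sum of an additive character over a norm cone. -/
noncomputable def coneSum (R : AddSubgroup F) (ψ : AddChar F ℂ) (α : A) (β : B) : ℂ :=
  ∑ v ∈ (normCone R A B).toFinset, traceChar A ψ (v.1 * α) * traceChar B ψ (v.2 * β)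

-- The pairs with b = 0 are split off; they all lie in the cone because 0 ∈ R. What remains is a sum
-- over pairs of units, where norm ratios make sense in Fˣ.
omit [Fintype F] in
theorem coneSum_eq (R : AddSubgroup F) (ψ : AddChar F ℂ) (α : A) (β : B) :
    coneSum R ψ α β = ∑ a : Aˣ, traceChar A ψ (a * α) +
      ∑ a : Aˣ, ∑ b : Bˣ, unitsIndicator R (unitsNorm F B b * (unitsNorm F A a)⁻¹) *
        (traceChar A ψ (a * α) * traceChar B ψ (b * β)) := by
  have hfin : FiniteDimensional F B := .of_finite
  have h1 : coneSum R ψ α β = ∑ a : Aˣ, ∑ b : B,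
      (if Algebra.norm F b * (Algebra.norm F (a : A))⁻¹ ∈ R then 1 else 0) *
        (traceChar A ψ (a * α) * traceChar B ψ (b * β)) := by
    rw [coneSum, sum_units_eq fun a : A ↦ ∑ b : B,
      (if Algebra.norm F b * (Algebra.norm F (a : A))⁻¹ ∈ R then 1 else 0) *
        (traceChar A ψ (a * α) * traceChar B ψ (b * β)), ← Finset.sum_erase_eq_sub (by simp),
      ← Finset.sum_product']
    simp only [ite_mul, one_mul, zero_mul]
    rw [← Finset.sum_filter]
    refine Finset.sum_congr ?_ fun _ _ ↦ rfl
    ext v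
    rw [Set.mem_toFinset]
    simp [normCone]
  rw [h1, ← Finset.sum_add_distrib]
  refine Finset.sum_congr rfl fun a _ ↦ ?_
  have h2 := sum_units_eq fun b : B ↦
    (if Algebra.norm F b * (Algebra.norm F (a : A))⁻¹ ∈ R then 1 else 0) *
        (traceChar A ψ (a * α) * traceChar B ψ (b * β))
  rw [eq_sub_iff_add_eq'] at h2
  rw [← h2, Algebra.norm_zero, zero_mul, if_pos R.zero_mem]
  congr 1
  · simp
  · refine Finset.sum_congr rfl fun b _ ↦ ?_
    simp [unitsIndicator]

theorem sum_unitsIndicator_norm_left (R : AddSubgroup F) (v : Fˣ) :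
    ∑ a : Aˣ, unitsIndicator R (v * (unitsNorm F A a)⁻¹) =
      Nat.card (unitsNorm F A).ker * (Nat.card R - 1) := by
  rw [MonoidHom.sum_comp_of_surjective _ (FiniteField.unitsMap_norm_surjective F A)
    fun u ↦ unitsIndicator R (v * u⁻¹), ← sum_unitsIndicator, nsmul_eq_mul,
    ← Equiv.sum_comp ((Equiv.inv Fˣ).trans (Equiv.mulLeft v)) (unitsIndicator R)]
  rfl

theorem sum_unitsIndicator_norm_right (R : AddSubgroup F) (v : Fˣ) :
    ∑ b : Bˣ, unitsIndicator R (unitsNorm F B b * v) =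
      Nat.card (unitsNorm F B).ker * (Nat.card R - 1) := by
  rw [MonoidHom.sum_comp_of_surjective _ (FiniteField.unitsMap_norm_surjective F B)
    fun u ↦ unitsIndicator R (u * v), ← sum_unitsIndicator, nsmul_eq_mul,
    ← Equiv.sum_comp (Equiv.mulRight v) (unitsIndicator R)]
  rfl

theorem sum_traceChar_units {ψ : AddChar F ℂ} (hψ : ψ ≠ 1) {α : A} (hα : α ≠ 0) :
    ∑ a : Aˣ, traceChar A ψ (a * α) = -1 := by
  rw [AddChar.sum_units_mulShift (traceChar_ne_one hψ), if_neg hα, zero_sub]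

theorem sum_one_units : ∑ _a : Aˣ, (1 : ℂ) = Fintype.card A - 1 := by
  rw [sum_units_eq fun _ ↦ (1 : ℂ)]
  simp

theorem coneSum_zero_right (R : AddSubgroup F) (ψ : AddChar F ℂ) (α : A) :
    coneSum R ψ α (0 : B) = (∑ a : Aˣ, traceChar A ψ (a * α)) *
      (1 + Nat.card (unitsNorm F B).ker * (Nat.card R - 1)) := by
  rw [coneSum_eq, mul_add, mul_one, Finset.sum_mul]
  congr 1
  refine Finset.sum_congr rfl fun a _ ↦ ?_
  rw [← sum_unitsIndicator_norm_right R (unitsNorm F A a)⁻¹, Finset.mul_sum]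
  exact Finset.sum_congr rfl fun b _ ↦ by simp [mul_comm]

theorem coneSum_zero_left (R : AddSubgroup F) {ψ : AddChar F ℂ} (hψ : ψ ≠ 1) {β : B}
    (hβ : β ≠ 0) :
    coneSum R ψ (0 : A) β = Fintype.card A - 1 -
      Nat.card (unitsNorm F A).ker * (Nat.card R - 1) := by
  have h : ∑ a : Aˣ, ∑ b : Bˣ, unitsIndicator R (unitsNorm F B b * (unitsNorm F A a)⁻¹) *
        (traceChar A ψ (a * 0) * traceChar B ψ (b * β)) =
      ∑ b : Bˣ, (Nat.card (unitsNorm F A).ker * (Nat.card R - 1)) * traceChar B ψ (b * β) := by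
    rw [Finset.sum_comm]
    refine Finset.sum_congr rfl fun b _ ↦ ?_
    rw [← sum_unitsIndicator_norm_left R (unitsNorm F B b), Finset.sum_mul]
    exact Finset.sum_congr rfl fun a _ ↦ by simp
  rw [coneSum_eq, h, ← Finset.mul_sum, sum_traceChar_units hψ hβ]
  simp only [mul_zero, AddChar.map_zero_eq_one, sum_one_units]
  ring

theorem coneSum_cases (R : AddSubgroup F) {ψ : AddChar F ℂ} (hψ : ψ ≠ 1)
    (h : Module.finrank F B = Module.finrank F A + 1) {α : A} {β : B} (hαβ : α ≠ 0 ∨ β ≠ 0) :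
    coneSum R ψ α β = Fintype.card A - 1 - Nat.card (unitsNorm F A).ker * (Nat.card R - 1) ∨
      coneSum R ψ α β = -1 - Nat.card (unitsNorm F B).ker * (Nat.card R - 1) := by
  by_cases hα : α = 0
  · subst hα
    exact .inl (coneSum_zero_left R hψ (by simpa using hαβ))
  by_cases hβ : β = 0
  · subst hβ
    right
    rw [coneSum_zero_right, sum_traceChar_units hψ hα]
    ring
  lift α to Aˣ using Ne.isUnit hα
  lift β to Bˣ using Ne.isUnit hβ
  have h1 : ∑ a : Aˣ, ∑ b : Bˣ, unitsIndicator R (unitsNorm F B b * (unitsNorm F A a)⁻¹) *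
        (traceChar A ψ (a * α) * traceChar B ψ (b * β)) =
      ∑ a : Aˣ, ∑ b : Bˣ, unitsIndicator R (unitsNorm F B b * (unitsNorm F A a)⁻¹ *
        ((unitsNorm F B β)⁻¹ * unitsNorm F A (-α))) *
        (traceChar A ψ (-a) * traceChar B ψ b) := by
    -- Substituting a ↦ -a/α and b ↦ b/β normalises the characters, at the cost of multiplying the
    -- norm ratio by N(-α)/N(β).
    rw [← Equiv.sum_comp (Equiv.mulRight (-α⁻¹))]
    refine Finset.sum_congr rfl fun a _ ↦ ?_
    rw [← Equiv.sum_comp (Equiv.mulRight (β⁻¹))]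
    refine Finset.sum_congr rfl fun b _ ↦ ?_
    congr 2
    · have : (-α⁻¹ : Aˣ) = (-α)⁻¹ := by rw [inv_neg]
      simp only [Equiv.coe_mulRight, this, map_mul, map_inv, mul_inv, inv_inv]
      exact Units.ext (by push_cast; ring)
    · simp
    · simp
  rw [coneSum_eq, sum_traceChar_units hψ hα, h1, sum_sum_norm_div hψ h fun u ↦
    unitsIndicator R (u * ((unitsNorm F B β)⁻¹ * unitsNorm F A (-α)))]
  set w := (unitsNorm F B β)⁻¹ * unitsNorm F A (-α)
  have h2 : ∑ u : Fˣ, unitsIndicator R (u * w) = Nat.card R - 1 := by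
    rw [← sum_unitsIndicator, ← Equiv.sum_comp (Equiv.mulRight w) (unitsIndicator R)]
    rfl
  have hA := card_ker_unitsNorm (F := F) A
  have hB := card_ker_unitsNorm (F := F) B
  have hcard : (Fintype.card B : ℂ) = Fintype.card A * Fintype.card F := by
    rw [Module.card_eq_pow_finrank (K := F) (V := B), Module.card_eq_pow_finrank (K := F) (V := A),
      h, pow_succ, Nat.cast_mul]
  have hF : (Fintype.card F : ℂ) - 1 ≠ 0 :=
    sub_ne_zero.2 (by exact_mod_cast (Fintype.one_lt_card (α := F)).ne')
  -- This identity between the kernel sizes makes the generic values coincide with those at α = 0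
  -- and β = 0.
  have hAB : (Nat.card (unitsNorm F B).ker : ℂ) =
      Fintype.card A + Nat.card (unitsNorm F A).ker := by
    apply mul_right_cancel₀ hF
    rw [hB, add_mul, hA, hcard]
    ring
  rw [h2, hAB]
  rcases sum_unitsIndicator_mul_addChar_cases R ψ w with h3 | h3
  · left
    rw [h3]
    ring
  · right
    rw [h3]
    ring

end ConeSum

/-! ### Point counts of cones and hyperplanes -/

section ProjectivePoints

open scoped Classical

variable {K V : Type*} [Field K] [AddCommGroup V] [Module K V]

/-- The points of the projective space spanned by the vectors of a cone. -/
def conePoints (T : Set V) : Set (Projectivization K V) := {P | P.rep ∈ T}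

theorem ncard_conePoints_mul [Finite K] [Finite V] {T : Set V} (h0 : 0 ∉ T)
    (hT : ∀ (u : Kˣ), ∀ v ∈ T, u • v ∈ T) :
    (conePoints T : Set (Projectivization K V)).ncard * (Nat.card K - 1) = T.ncard := by
  rw [← Nat.card_units, ← Nat.card_coe_set_eq, ← Nat.card_coe_set_eq, ← Nat.card_prod]
  refine Nat.card_congr (Equiv.ofBijective
    (fun x : {P : Projectivization K V // P ∈ conePoints T} × Kˣ ↦
      (⟨x.2 • x.1.1.rep, hT _ _ x.1.2⟩ : T)) ⟨?_, ?_⟩)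
  · rintro ⟨⟨P, hP⟩, u⟩ ⟨⟨P', hP'⟩, u'⟩ h
    have h : u • P.rep = u' • P'.rep := congrArg Subtype.val h
    obtain rfl : P = P' := by
      rw [← P.mk_rep, ← P'.mk_rep, Projectivization.mk_eq_mk_iff]
      exact ⟨u⁻¹ * u', by rw [mul_smul, ← h, inv_smul_smul]⟩
    have h2 : (u : K) = u' := smul_left_injective K P.rep_nonzero h
    rw [Units.ext h2]
  · rintro ⟨v, hv⟩
    have hv0 : v ≠ 0 := fun h ↦ h0 (h ▸ hv)
    obtain ⟨u, hu⟩ := Projectivization.exists_smul_eq_mk_rep K v hv0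
    exact ⟨⟨⟨.mk K v hv0, by rw [conePoints, Set.mem_ofPred_eq, ← hu]; exact hT u v hv⟩, u⁻¹⟩,
      Subtype.ext (by simp [← hu])⟩

theorem conePoints_inter (T : Set V) (H : Submodule K V) :
    {P : Projectivization K V | P ∈ conePoints T ∧ P.submodule ≤ H} =
      conePoints (T ∩ (H : Set V)) := by
  ext P
  rw [conePoints, conePoints, Set.mem_ofPred_eq, Projectivization.submodule_eq,
    Submodule.span_singleton_le_iff_mem]
  rfl

/-- The number of vectors of a cone in the kernel of a functional, through a character sum. -/
theorem card_mul_ncard_inter_ker [Fintype K] [Finite V] {ψ : AddChar K ℂ} (hψ : ψ ≠ 1)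
    {T : Set V} (hT : ∀ (u : Kˣ), ∀ v ∈ T, u • v ∈ T) (φ : V →ₗ[K] K) :
    (Fintype.card K : ℂ) * (T ∩ (LinearMap.ker φ : Set V)).ncard =
      T.ncard + (Fintype.card K - 1) * ∑ v ∈ T.toFinite.toFinset, ψ (φ v) := by
  have h1 (v : V) : ∑ c : K, ψ (c * φ v) = if φ v = 0 then (Fintype.card K : ℂ) else 0 := by
    rw [AddChar.sum_mulShift _ (.of_ne_one hψ)]
    simp
  have h2 : ∑ v ∈ T.toFinite.toFinset, ∑ c : K, ψ (c * φ v) =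
      Fintype.card K * (T ∩ (LinearMap.ker φ : Set V)).ncard := by
    simp_rw [h1]
    rw [← Finset.sum_filter, Finset.sum_const, nsmul_eq_mul, mul_comm, ← Set.ncard_coe_finset]
    congr 3
    ext v
    simp
  -- As the cone is stable under scalars, every nonzero c contributes the same sum.
  have h3 (u : Kˣ) : ∑ v ∈ T.toFinite.toFinset, ψ (u * φ v) =
      ∑ v ∈ T.toFinite.toFinset, ψ (φ v) := by
    refine Finset.sum_bij' (fun v _ ↦ u • v) (fun v _ ↦ u⁻¹ • v) ?_ ?_ ?_ ?_ ?_
    · simpa using hT u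
    · simpa using hT u⁻¹
    · simp
    · simp
    · intro v _
      rw [Units.smul_def, map_smul, smul_eq_mul]
  have h4 := sum_units_eq fun c : K ↦ ∑ v ∈ T.toFinite.toFinset, ψ (c * φ v)
  rw [eq_sub_iff_add_eq'] at h4
  rw [← h2, Finset.sum_comm, ← h4]
  simp_rw [h3]
  rw [Finset.sum_const, Finset.card_univ, Fintype.card_units, nsmul_eq_mul,
    Nat.cast_sub Fintype.card_pos, Nat.cast_one, Set.ncard_eq_toFinset_card T]
  simp

theorem exists_ker_eq_of_finrank_add_one [FiniteDimensional K V] {H : Submodule K V}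
    (hH : Module.finrank K H + 1 = Module.finrank K V) :
    ∃ φ : V →ₗ[K] K, φ ≠ 0 ∧ LinearMap.ker φ = H := by
  have hlt : H < ⊤ := by
    rw [lt_top_iff_ne_top]
    rintro rfl
    rw [finrank_top] at hH
    omega
  obtain ⟨φ, hφ, hle⟩ := H.exists_le_ker_of_lt_top hlt
  refine ⟨φ, hφ, (Submodule.eq_of_le_of_finrank_le hle ?_).symm⟩
  have h1 := φ.finrank_range_add_finrank_ker
  have h2 : Module.finrank K (LinearMap.range φ) ≠ 0 := by
    rw [Ne, Submodule.finrank_eq_zero, LinearMap.range_eq_bot]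
    exact hφ
  omega

theorem exists_submodule_finrank_eq [FiniteDimensional K V] {r : ℕ} (hr : r ≤ Module.finrank K V) :
    ∃ R : Submodule K V, Module.finrank K R = r := by
  obtain ⟨f, hf⟩ := exists_linearIndependent_of_le_finrank hr
  exact ⟨Submodule.span K (Set.range f), by simpa using finrank_span_eq_card hf⟩

theorem ncard_le_submodule_mul [Finite K] [Finite V] (H : Submodule K V) :
    {P : Projectivization K V | P.submodule ≤ H}.ncard * (Nat.card K - 1) = Nat.card H - 1 := by
  have h : {P : Projectivization K V | P.submodule ≤ H} =
      conePoints ({0}ᶜ ∩ (H : Set V)) := by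
    rw [← conePoints_inter]
    ext P
    simp [conePoints, P.rep_nonzero]
  rw [h, ncard_conePoints_mul (by simp)]
  · rw [Set.inter_comm, ← Set.sdiff_eq, Set.ncard_sdiff_singleton_of_mem H.zero_mem,
      ← Nat.card_coe_set_eq]
    rfl
  · rintro u v ⟨h1, h2⟩
    exact ⟨fun h ↦ h1 ((smul_eq_zero_iff_eq u).1 h), H.smul_mem (u : K) h2⟩

end ProjectivePoints

/-! ### The norm cone over the small field and trace duality -/

section NormCone

open scoped Classical

variable {K F A B : Type*} [Field K] [Field F] [Field A] [Field B] [Algebra K F] [Algebra F A]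
  [Algebra F B] [Algebra K A] [Algebra K B] [IsScalarTower K F A] [IsScalarTower K F B]

omit [Algebra F B] [Algebra K B] [IsScalarTower K F B] in
theorem norm_units_smul (u : Kˣ) (x : A) :
    Algebra.norm F (u • x) = algebraMap K F u ^ Module.finrank F A * Algebra.norm F x := by
  rw [Units.smul_def, ← algebraMap_smul F (u : K) x, Algebra.smul_def, map_mul,
    Algebra.norm_algebraMap]

/-- The norms from B and A have consecutive degrees, so u in K scales their ratio by exactly u.
Hence R need only be a K-subspace of F. -/
theorem smul_mem_normCone (h : Module.finrank F B = Module.finrank F A + 1)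
    (R : Submodule K F) (u : Kˣ) (v : A × B) (hv : v ∈ normCone R.toAddSubgroup A B) :
    u • v ∈ normCone R.toAddSubgroup A B := by
  obtain ⟨h1, h2⟩ := hv
  refine ⟨fun h ↦ h1 ((smul_eq_zero_iff_eq u).1 h), ?_⟩
  have hu : algebraMap K F u ≠ 0 := by simp
  have h3 : Algebra.norm F (u • v).2 * (Algebra.norm F (u • v).1)⁻¹ =
      (u : K) • (Algebra.norm F v.2 * (Algebra.norm F v.1)⁻¹) := by
    rw [Prod.smul_fst, Prod.smul_snd, norm_units_smul, norm_units_smul, h, Algebra.smul_def]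
    field_simp
    ring
  rw [h3]
  exact R.smul_mem _ h2

variable (K) in
/-- The functional on `A × B` that a pair represents through the trace forms. -/
noncomputable def tracePairing (α : A) (β : B) : A × B →ₗ[K] K :=
  (Algebra.traceForm K A α).coprod (Algebra.traceForm K B β)

theorem exists_tracePairing_eq [Finite K] [Finite A] [Finite B] (φ : A × B →ₗ[K] K) :
    ∃ (α : A) (β : B), tracePairing K α β = φ := by
  refine ⟨((Algebra.traceForm K A).toDual (traceForm_nondegenerate K A)).symm
    (φ ∘ₗ LinearMap.inl K A B), ((Algebra.traceForm K B).toDual (traceForm_nondegenerate K B)).symm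
    (φ ∘ₗ LinearMap.inr K A B), ?_⟩
  ext x
  · simp [tracePairing]
  · simp [tracePairing]

/-- By transitivity of the trace, ψ composed with traces to K is the character ψ ∘ Tr of F composed
with traces to F. -/
theorem sum_normCone_tracePairing [Fintype A] [Fintype B] [Finite F] (R : AddSubgroup F)
    (ψ : AddChar K ℂ) (α : A) (β : B) :
    ∑ v ∈ (normCone R A B).toFinite.toFinset, ψ (tracePairing K α β v) =
      coneSum R (traceChar F ψ) α β := by
  rw [coneSum]
  refine Finset.sum_congr (by ext; simp) fun v _ ↦ ?_
  have : FiniteDimensional F A := .of_finite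
  have : FiniteDimensional F B := .of_finite
  have : FiniteDimensional K F := .of_finite
  simp [tracePairing, AddChar.map_add_eq_mul, Algebra.trace_trace, mul_comm]

end NormCone

/-! ### Point counts of the norm cone -/

section ProjectiveSets

open scoped Classical

variable {K F A B V : Type*} [Field K] [Field F] [Field A] [Field B] [Algebra K F] [Algebra F A]
  [Algebra F B] [Algebra K A] [Algebra K B] [IsScalarTower K F A] [IsScalarTower K F B]
  [Fintype K] [Fintype F] [Fintype A] [Fintype B] [AddCommGroup V] [Module K V] [Finite V]

omit [Fintype K] [Fintype F] [Fintype A] [Fintype B] [Finite V] in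
theorem smul_mem_preimage_normCone (h : Module.finrank F B = Module.finrank F A + 1)
    (R : Submodule K F) (e : V ≃ₗ[K] A × B) (u : Kˣ) (v : V)
    (hv : v ∈ e ⁻¹' normCone R.toAddSubgroup A B) :
    u • v ∈ e ⁻¹' normCone R.toAddSubgroup A B := by
  have h1 : e (u • v) = u • e v := e.map_smul (u : K) v
  rw [Set.mem_preimage, h1]
  exact smul_mem_normCone h R u _ hv

theorem ncard_conePoints_normCone (h : Module.finrank F B = Module.finrank F A + 1)
    (R : Submodule K F) (e : V ≃ₗ[K] A × B) :
    ((conePoints (e ⁻¹' normCone R.toAddSubgroup A B) : Set (Projectivization K V)).ncard : ℂ) *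
      (Nat.card K - 1) = (Nat.card A - 1) *
        (1 + Nat.card (unitsNorm F B).ker * (Nat.card R - 1)) := by
  have h1 := ncard_conePoints_mul (K := K) (T := e ⁻¹' normCone R.toAddSubgroup A B)
    (by simp [normCone]) (smul_mem_preimage_normCone h R e)
  have h2 : (e ⁻¹' normCone R.toAddSubgroup A B).ncard = (normCone R.toAddSubgroup A B).ncard :=
    Set.ncard_preimage_of_injective_subset_range e.injective (by simp [e.surjective.range_eq])
  -- The size of the cone is its character sum at the trivial character.
  have h3 : ((normCone R.toAddSubgroup A B).ncard : ℂ) =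
      coneSum R.toAddSubgroup (1 : AddChar F ℂ) (0 : A) (0 : B) := by
    rw [coneSum, Set.ncard_eq_toFinset_card']
    simp
  rw [h2] at h1
  have h4 : ((Nat.card K - 1 : ℕ) : ℂ) = Nat.card K - 1 := by
    rw [Nat.cast_sub Nat.card_pos, Nat.cast_one]
  rw [← h4, ← Nat.cast_mul, h1, h3, coneSum_zero_right]
  simp only [mul_zero, AddChar.map_zero_eq_one, sum_one_units, Nat.card_eq_fintype_card]
  rfl

theorem card_mul_ncard_conePoints_le_ker (h : Module.finrank F B = Module.finrank F A + 1)
    (R : Submodule K F) (e : V ≃ₗ[K] A × B) {ψ : AddChar K ℂ} (hψ : ψ ≠ 1) (α : A) (β : B) :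
    (Nat.card K : ℂ) * {P : Projectivization K V |
      P ∈ conePoints (e ⁻¹' normCone R.toAddSubgroup A B) ∧
        P.submodule ≤ LinearMap.ker (tracePairing K α β ∘ₗ e.toLinearMap)}.ncard =
      (conePoints (e ⁻¹' normCone R.toAddSubgroup A B) : Set (Projectivization K V)).ncard +
        coneSum R.toAddSubgroup (traceChar F ψ) α β := by
  set φ := tracePairing K α β ∘ₗ e.toLinearMap
  set T := e ⁻¹' normCone R.toAddSubgroup A B
  have hT := smul_mem_preimage_normCone h R e
  have h1 := card_mul_ncard_inter_ker hψ hT φ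
  have h2 := ncard_conePoints_mul (K := K) (T := T) (by simp [T, normCone]) hT
  have h3 := ncard_conePoints_mul (K := K) (T := T ∩ (LinearMap.ker φ : Set V))
    (by simp [T, normCone]) fun u v hv ↦ ⟨hT u v hv.1, (LinearMap.ker φ).smul_mem (u : K) hv.2⟩
  have h4 : ∑ v ∈ T.toFinite.toFinset, ψ (φ v) =
      coneSum R.toAddSubgroup (traceChar F ψ) α β := by
    rw [← sum_normCone_tracePairing]
    exact Finset.sum_bij' (fun v _ ↦ e v) (fun w _ ↦ e.symm w) (by simp [T]) (by simp [T])
      (by simp) (by simp) (by simp [φ])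
  have h5 : ((Nat.card K - 1 : ℕ) : ℂ) = Nat.card K - 1 := by
    rw [Nat.cast_sub Nat.card_pos, Nat.cast_one]
  have h6 : (Nat.card K : ℂ) - 1 ≠ 0 :=
    sub_ne_zero.2 (by exact_mod_cast (Finite.one_lt_card (α := K)).ne')
  rw [conePoints_inter]
  apply mul_right_cancel₀ h6
  rw [← Nat.card_eq_fintype_card, h4, ← h2, ← h3, Nat.cast_mul, Nat.cast_mul, h5] at h1
  linear_combination h1

end ProjectiveSets

/-! ### Existence of the sets and of their complements -/

section Existence

theorem exists_addChar_ne_one (K : Type*) [Field K] [Finite K] : ∃ ψ : AddChar K ℂ, ψ ≠ 1 := by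
  obtain ⟨ψ, hψ⟩ := AddChar.exists_apply_ne_zero.2 (one_ne_zero (α := K))
  exact ⟨ψ, AddChar.ne_one_iff.2 ⟨1, hψ⟩⟩

/-- Every hyperplane is the kernel of a trace pairing, so `coneSum_cases` bounds the possible
counts. The parameters are actual cardinalities, hence natural numbers, and are pinned down by
equations free of division. Those of the complement follow by subtraction from all points of the
space or of a hyperplane. -/
theorem exists_isProjectiveSet_compl_of_equiv {K F A B : Type*} [Field K] [Field F] [Field A]
    [Field B] [Algebra K F] [Algebra F A] [Algebra F B] [Algebra K A] [Algebra K B]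
    [IsScalarTower K F A] [IsScalarTower K F B] [Finite K] [Fintype F] [Fintype A] [Fintype B]
    {q M Q Q' ρ N : ℕ} {R : Submodule K F} (hK : Nat.card K = q) (cF : Nat.card F = M)
    (cA : Nat.card A = Q) (cB : Nat.card B = Q') (cR : Nat.card R = ρ)
    (h : Module.finrank F B = Module.finrank F A + 1) (e : (Fin N → K) ≃ₗ[K] A × B) :
    ∃ (O : Set (Projectivization K (Fin N → K))) (n h₁ h₂ n' h₁' h₂' : ℕ),
      IsProjectiveSet K n N h₁ h₂ O ∧ IsProjectiveSet K n' N h₁' h₂' Oᶜ ∧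
      (n : ℚ) * (q - 1) * (M - 1) = (Q - 1) * (M - 1 + (Q' - 1) * (ρ - 1)) ∧
      (q : ℚ) * h₁ * (M - 1) = (n - 1) * (M - 1) - (Q' - 1) * (ρ - 1) ∧
      (q : ℚ) * h₂ * (M - 1) = (n + Q - 1) * (M - 1) - (Q - 1) * (ρ - 1) ∧
      ((n' : ℚ) + n) * (q - 1) = q ^ N - 1 ∧
      ((h₁' : ℚ) + h₂) * (q - 1) = q ^ (N - 1) - 1 ∧
      ((h₂' : ℚ) + h₁) * (q - 1) = q ^ (N - 1) - 1 := by
  have := Fintype.ofFinite K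
  have hdim : FiniteDimensional F A := .of_finite
  have hdim' : FiniteDimensional F B := .of_finite
  have hdim'' : FiniteDimensional K A := .of_finite
  have hdim''' : FiniteDimensional K B := .of_finite
  have hdimF : FiniteDimensional K F := .of_finite
  obtain ⟨ψ, hψ⟩ := exists_addChar_ne_one K
  have hψF : traceChar F ψ ≠ 1 := traceChar_ne_one hψ
  have hq : 1 < q := hK ▸ Finite.one_lt_card
  let O : Set (Projectivization K (Fin N → K)) := conePoints (e ⁻¹' normCone R.toAddSubgroup A B)
  let cnt (X : Set (Projectivization K (Fin N → K))) (H : Submodule K (Fin N → K)) : ℕ :=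
    {P | P ∈ X ∧ P.submodule ≤ H}.ncard
  let φ (α : A) (β : B) : (Fin N → K) →ₗ[K] K := tracePairing K α β ∘ₗ e.toLinearMap
  have hn := ncard_conePoints_normCone h R e
  have hcnt (α : A) (β : B) : (q : ℂ) * cnt O (LinearMap.ker (φ α β)) = O.ncard +
      coneSum R.toAddSubgroup (traceChar F ψ) α β := by
    rw [← hK]
    exact card_mul_ncard_conePoints_le_ker h R e hψ α β
  have hcard {H : Submodule K (Fin N → K)} (hH : Module.finrank K H + 1 = N) :
      (cnt Oᶜ H + cnt O H) * (q - 1) = q ^ (N - 1) - 1 := by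
    have h1 : cnt Oᶜ H + cnt O H =
        {P : Projectivization K (Fin N → K) | P.submodule ≤ H}.ncard := by
      rw [add_comm, ← Set.ncard_union_eq]
      · congr 1
        ext P
        simp only [Set.mem_union, Set.mem_ofPred_eq, Set.mem_compl_iff]
        tauto
      · exact Set.disjoint_left.2 fun P h1 h2 ↦ h2.1 h1.1
    rw [h1, ← hK, ncard_le_submodule_mul, Module.natCard_eq_pow_finrank (K := K) (V := H)]
    congr 2
    omega
  have hker {f : (Fin N → K) →ₗ[K] K} (hf : f ≠ 0) :
      Module.finrank K (LinearMap.ker f) + 1 = N := by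
    rw [Module.Dual.finrank_ker_add_one_of_ne_zero hf]
    simp
  have hne₁ : φ 1 0 ≠ 0 := by
    intro h0
    obtain ⟨x, hx⟩ := Algebra.trace_surjective K A 1
    have := LinearMap.congr_fun h0 (e.symm (x, 0))
    simp [φ, tracePairing, hx] at this
  have hne₂ : φ 0 1 ≠ 0 := by
    intro h0
    obtain ⟨x, hx⟩ := Algebra.trace_surjective K B 1
    have := LinearMap.congr_fun h0 (e.symm (0, x))
    simp [φ, tracePairing, hx] at this
  -- The hyperplanes Tr a = 0 and Tr b = 0 realise the two values.
  set H₁ := LinearMap.ker (φ 1 0)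
  set H₂ := LinearMap.ker (φ 0 1)
  have hc₁ : (q : ℂ) * cnt O H₁ = O.ncard +
      (-1 - Nat.card (unitsNorm F B).ker * (Nat.card R - 1)) := by
    rw [hcnt, coneSum_zero_right, sum_traceChar_units hψF one_ne_zero]
    change _ + -1 * (1 + _ * ((Nat.card R : ℂ) - 1)) = _
    ring
  have hc₂ : (q : ℂ) * cnt O H₂ = O.ncard +
      (Nat.card A - 1 - Nat.card (unitsNorm F A).ker * (Nat.card R - 1)) := by
    rw [hcnt, coneSum_zero_left _ hψF one_ne_zero, ← Nat.card_eq_fintype_card (α := A)]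
    rfl
  have hall {H : Submodule K (Fin N → K)} (hH : Module.finrank K H + 1 = N) :
      cnt O H = cnt O H₁ ∨ cnt O H = cnt O H₂ := by
    obtain ⟨f, hf, rfl⟩ := exists_ker_eq_of_finrank_add_one (hH.trans (by simp))
    obtain ⟨α, β, hαβ⟩ := exists_tracePairing_eq (f ∘ₗ e.symm.toLinearMap)
    have hfφ : f = φ α β := by
      ext x
      simp [φ, hαβ]
    have h0 : α ≠ 0 ∨ β ≠ 0 := by
      by_contra! h0
      apply hf
      rw [hfφ, h0.1, h0.2]
      ext x
      simp [φ, tracePairing]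
    have hq0 : (q : ℂ) ≠ 0 := by exact_mod_cast (by omega : q ≠ 0)
    have h1 := hcnt α β
    rw [← hfφ] at h1
    rcases coneSum_cases R.toAddSubgroup hψF h h0 with h2 | h2
    · right
      rw [h2, ← Nat.card_eq_fintype_card (α := A)] at h1
      exact_mod_cast mul_left_cancel₀ hq0 (h1.trans hc₂.symm)
    · left
      rw [h2] at h1
      exact_mod_cast mul_left_cancel₀ hq0 (h1.trans hc₁.symm)
  -- Scalar invariance lets membership of a point be tested on any vector spanning it. The vector
  -- (1, 0) then gives a point of the set, and (0, 1) a point outside it.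
  have hmk {v : A × B} (hv : v ≠ 0) : ∃ P : Projectivization K (Fin N → K),
      P ∈ O ↔ v ∈ normCone R.toAddSubgroup A B := by
    have hv' : e.symm v ≠ 0 := by simpa using hv
    obtain ⟨u, hu⟩ := Projectivization.exists_smul_eq_mk_rep K (e.symm v) hv'
    have hinv := smul_mem_preimage_normCone h R e
    refine ⟨.mk K _ hv', ?_⟩
    simp only [O, conePoints, Set.mem_ofPred_eq]
    rw [← hu]
    refine ⟨fun h1 ↦ ?_, fun h1 ↦ hinv u _ (by simpa using h1)⟩
    simpa using hinv u⁻¹ _ h1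
  have hnon : O.Nonempty := by
    obtain ⟨P, hP⟩ := hmk (v := (1, 0)) (by simp)
    exact ⟨P, hP.2 ⟨one_ne_zero, by simp⟩⟩
  have hnon' : Oᶜ.Nonempty := by
    obtain ⟨P, hP⟩ := hmk (v := (0, 1)) (by simp)
    exact ⟨P, fun h1 ↦ (hP.1 h1).1 rfl⟩
  have hkA := card_ker_unitsNorm (F := F) A
  have hkB := card_ker_unitsNorm (F := F) B
  rw [← Nat.card_eq_fintype_card, ← Nat.card_eq_fintype_card, cF, cA] at hkA
  rw [← Nat.card_eq_fintype_card, ← Nat.card_eq_fintype_card, cF, cB] at hkB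
  rw [hK, cA, cR] at hn
  rw [cR] at hc₁
  rw [cA, cR] at hc₂
  replace hkA : (Nat.card (unitsNorm F A).ker : ℚ) * (M - 1) = Q - 1 :=
    Rat.cast_injective (α := ℂ) (by push_cast; exact hkA)
  replace hkB : (Nat.card (unitsNorm F B).ker : ℚ) * (M - 1) = Q' - 1 :=
    Rat.cast_injective (α := ℂ) (by push_cast; exact hkB)
  replace hn : (O.ncard : ℚ) * (q - 1) =
      (Q - 1) * (1 + Nat.card (unitsNorm F B).ker * (ρ - 1)) :=
    Rat.cast_injective (α := ℂ) (by push_cast; exact hn)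
  replace hc₁ : (q : ℚ) * cnt O H₁ =
      O.ncard + (-1 - Nat.card (unitsNorm F B).ker * (ρ - 1)) :=
    Rat.cast_injective (α := ℂ) (by push_cast; exact hc₁)
  replace hc₂ : (q : ℚ) * cnt O H₂ =
      O.ncard + (Q - 1 - Nat.card (unitsNorm F A).ker * (ρ - 1)) :=
    Rat.cast_injective (α := ℂ) (by push_cast; exact hc₂)
  have hcast : ((q - 1 : ℕ) : ℚ) = q - 1 := by rw [Nat.cast_sub hq.le, Nat.cast_one]
  have hcast' (k : ℕ) : ((q ^ k - 1 : ℕ) : ℚ) = q ^ k - 1 := by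
    rw [Nat.cast_sub (Nat.one_le_pow _ _ (by omega)), Nat.cast_pow, Nat.cast_one]
  have e₁ := hcard (hker hne₁)
  have e₂ := hcard (hker hne₂)
  have hq1 : 0 < q - 1 := by omega
  -- The two hyperplane counts of the complement are swapped, to match the order in the second
  -- family.
  refine ⟨O, O.ncard, cnt O H₁, cnt O H₂, Oᶜ.ncard, cnt Oᶜ H₂, cnt Oᶜ H₁,
    ⟨hnon, (Set.nonempty_compl.1 hnon'), rfl, fun H hH ↦ hall hH⟩,
    ⟨hnon', fun h1 ↦ ?_, rfl, fun H hH ↦ ?_⟩, ?_, ?_, ?_, ?_, ?_, ?_⟩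
  · rw [Set.compl_univ_iff] at h1
    exact hnon.ne_empty h1
  · have e₃ := hcard hH
    rcases hall hH with h1 | h1
    · right
      have := Nat.eq_of_mul_eq_mul_right hq1 (e₃.trans e₁.symm)
      rw [h1] at this
      exact Nat.add_right_cancel this
    · left
      have := Nat.eq_of_mul_eq_mul_right hq1 (e₃.trans e₂.symm)
      rw [h1] at this
      exact Nat.add_right_cancel this
  · linear_combination (M - 1 : ℚ) * hn + (Q - 1 : ℚ) * (ρ - 1) * hkB
  · linear_combination (M - 1 : ℚ) * hc₁ - (ρ - 1 : ℚ) * hkB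
  · linear_combination (M - 1 : ℚ) * hc₂ - (ρ - 1 : ℚ) * hkA
  · rw [← hcast, ← hcast', ← Nat.cast_add, ← Nat.cast_mul, add_comm, Set.ncard_add_ncard_compl]
    congr 1
    rw [← hK, ← Projectivization.card, Nat.card_fun]
    simp
  · rw [← hcast, ← hcast', ← e₂, Nat.cast_mul, Nat.cast_add]
  · rw [← hcast, ← hcast', ← e₁, Nat.cast_mul, Nat.cast_add]

/-- Extensions of degrees `ℓ` and `ℓ + 1` of an extension of degree `m` yield a cone in a space of
dimension `m * (2 * ℓ + 1)` whose points meet hyperplanes in one of two numbers of points, and so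
does the complement. -/
theorem exists_isProjectiveSet_compl (K : Type*) [Field K] [Finite K] {q m ℓ r : ℕ}
    (hK : Nat.card K = q) (hm : 1 ≤ m) (hℓ : 1 ≤ ℓ) (hr : r ≤ m) :
    ∃ (O : Set (Projectivization K (Fin (m * (2 * ℓ + 1)) → K))) (n h₁ h₂ n' h₁' h₂' : ℕ),
      IsProjectiveSet K n (m * (2 * ℓ + 1)) h₁ h₂ O ∧
      IsProjectiveSet K n' (m * (2 * ℓ + 1)) h₁' h₂' Oᶜ ∧
      (n : ℚ) * (q - 1) * (q ^ m - 1) = (q ^ (m * ℓ) - 1) * (q ^ m - 1 +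
        (q ^ (m * (ℓ + 1)) - 1) * (q ^ r - 1)) ∧
      (q : ℚ) * h₁ * (q ^ m - 1) =
        (n - 1) * (q ^ m - 1) - (q ^ (m * (ℓ + 1)) - 1) * (q ^ r - 1) ∧
      (q : ℚ) * h₂ * (q ^ m - 1) = (n + q ^ (m * ℓ) - 1) * (q ^ m - 1) -
        (q ^ (m * ℓ) - 1) * (q ^ r - 1) ∧
      ((n' : ℚ) + n) * (q - 1) = q ^ (m * (2 * ℓ + 1)) - 1 ∧
      ((h₁' : ℚ) + h₂) * (q - 1) = q ^ (m * (2 * ℓ + 1) - 1) - 1 ∧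
      ((h₂' : ℚ) + h₁) * (q - 1) = q ^ (m * (2 * ℓ + 1) - 1) - 1 := by
  obtain ⟨p, hp⟩ := CharP.exists K
  have : Fact p.Prime := ⟨CharP.char_is_prime K p⟩
  have : NeZero m := ⟨by omega⟩
  have : NeZero ℓ := ⟨by omega⟩
  let F := FiniteField.Extension K p m
  have : CharP F p := charP_of_injective_algebraMap (algebraMap K F).injective p
  let A := FiniteField.Extension F p ℓ
  let B := FiniteField.Extension F p (ℓ + 1)
  let : Algebra K A := ((algebraMap F A).comp (algebraMap K F)).toAlgebra
  let : Algebra K B := ((algebraMap F B).comp (algebraMap K F)).toAlgebra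
  have : IsScalarTower K F A := .of_algebraMap_eq' rfl
  have : IsScalarTower K F B := .of_algebraMap_eq' rfl
  have : Fintype K := .ofFinite K
  have : Fintype F := .ofFinite F
  have : Fintype A := .ofFinite A
  have : Fintype B := .ofFinite B
  have hF : Module.finrank K F = m := FiniteField.finrank_extension K p m
  have hA : Module.finrank F A = ℓ := FiniteField.finrank_extension F p ℓ
  have hB : Module.finrank F B = ℓ + 1 := FiniteField.finrank_extension F p (ℓ + 1)
  have hBA : Module.finrank F B = Module.finrank F A + 1 := by rw [hA, hB]
  have hKA : Module.finrank K A = m * ℓ := by rw [← Module.finrank_mul_finrank K F A, hF, hA]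
  have hKB : Module.finrank K B = m * (ℓ + 1) := by
    rw [← Module.finrank_mul_finrank K F B, hF, hB]
  obtain ⟨R, hR⟩ := exists_submodule_finrank_eq (hF.symm ▸ hr : r ≤ Module.finrank K F)
  have cF : Nat.card F = q ^ m := by rw [Module.natCard_eq_pow_finrank (K := K), hK, hF]
  have cA : Nat.card A = q ^ (m * ℓ) := by rw [Module.natCard_eq_pow_finrank (K := K), hK, hKA]
  have cB : Nat.card B = q ^ (m * (ℓ + 1)) := by
    rw [Module.natCard_eq_pow_finrank (K := K), hK, hKB]
  have cR : Nat.card R = q ^ r := by rw [Module.natCard_eq_pow_finrank (K := K), hK, hR]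
  obtain ⟨N, hN⟩ : ∃ N, N = m * (2 * ℓ + 1) := ⟨_, rfl⟩
  rw [← hN]
  have hV : Module.finrank K (Fin N → K) = N := by simp
  let e : (Fin N → K) ≃ₗ[K] A × B := LinearEquiv.ofFinrankEq _ _ (by
    rw [hV, Module.finrank_prod, hKA, hKB, hN]
    ring)
  have := exists_isProjectiveSet_compl_of_equiv hK cF cA cB cR hBA e
  push_cast at this
  exact this

end Existence

/-- The two families of projective sets; for `ℓ = r = 1` the parameters of the first family are
those of De Winter's projective sets. The parameters are given as quotients in `ℚ`; that they are
natural numbers is part of the claim. No subtraction in an exponent is truncated, as `1 ≤ m`,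
`1 ≤ ℓ` and `r ≤ m`. -/
theorem mainTheorem3 (q : ℕ) (hq : IsPrimePow q) (K : Type*) [Field K] [Finite K]
    (hK : Nat.card K = q) (m ℓ : ℕ) (hm : 1 ≤ m) (hℓ : 1 ≤ ℓ) (r : ℕ) (hr : r ≤ m) :
    (∃ n h₁ h₂ : ℕ,
      (n : ℚ) = (((q : ℚ) ^ r - 1) * ((q : ℚ) ^ (m * ℓ) - 1) * ((q : ℚ) ^ (m * (ℓ + 1)) - 1))
          / (((q : ℚ) - 1) * ((q : ℚ) ^ m - 1))
        + ((q : ℚ) ^ (m * ℓ) - 1) / ((q : ℚ) - 1) ∧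
      (h₁ : ℚ) = (((q : ℚ) ^ (m * ℓ - 1) - 1)
          * ((q : ℚ) ^ (m * (ℓ + 1) + r) - (q : ℚ) ^ (m * (ℓ + 1)) + (q : ℚ) ^ m - (q : ℚ) ^ r))
          / (((q : ℚ) - 1) * ((q : ℚ) ^ m - 1)) ∧
      (h₂ : ℚ) = (((q : ℚ) ^ (m * ℓ) - 1)
          * ((q : ℚ) ^ (m * (ℓ + 1) + r - 1) - (q : ℚ) ^ (m * (ℓ + 1) - 1)
            + (q : ℚ) ^ m - (q : ℚ) ^ r))
          / (((q : ℚ) - 1) * ((q : ℚ) ^ m - 1)) ∧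
      (ℓ = 1 → r = 1 →
        (n : ℚ) = (((q : ℚ) ^ m - 1) * ((q : ℚ) ^ (m + 1) - (q : ℚ) ^ m + q)) / ((q : ℚ) - 1) ∧
        (h₁ : ℚ) = ((q : ℚ) ^ (2 * m) - (q : ℚ) ^ (2 * m - 1) - (q : ℚ) ^ (m + 1)
          + 2 * (q : ℚ) ^ m - q) / ((q : ℚ) - 1) ∧
        (h₂ : ℚ) = ((q : ℚ) ^ (2 * m) - (q : ℚ) ^ (2 * m - 1) + (q : ℚ) ^ m - q)
          / ((q : ℚ) - 1)) ∧
      ∃ O : Set (Projectivization K (Fin (m * (2 * ℓ + 1)) → K)),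
        IsProjectiveSet K n (m * (2 * ℓ + 1)) h₁ h₂ O) ∧
    (∃ n h₁ h₂ : ℕ,
      (n : ℚ) = (((q : ℚ) ^ m - (q : ℚ) ^ (m - r)) * ((q : ℚ) ^ (m * ℓ) - 1)
            * ((q : ℚ) ^ (m * (ℓ + 1)) - 1))
          / (((q : ℚ) - 1) * ((q : ℚ) ^ m - 1))
        + ((q : ℚ) ^ (m * (ℓ + 1)) - 1) / ((q : ℚ) - 1) ∧
      (h₁ : ℚ) = (((q : ℚ) ^ (m * (ℓ + 1) - 1) - 1)
          * ((q : ℚ) ^ (m * (ℓ + 1)) - (q : ℚ) ^ (m * (ℓ + 1) - r) + (q : ℚ) ^ (m - r) - 1))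
          / (((q : ℚ) - 1) * ((q : ℚ) ^ m - 1)) ∧
      (h₂ : ℚ) = (((q : ℚ) ^ (m * (ℓ + 1)) - 1)
          * ((q : ℚ) ^ (m * (ℓ + 1) - 1) - (q : ℚ) ^ (m * (ℓ + 1) - r - 1)
            + (q : ℚ) ^ (m - r) - 1))
          / (((q : ℚ) - 1) * ((q : ℚ) ^ m - 1)) ∧
      ∃ O : Set (Projectivization K (Fin (m * (2 * ℓ + 1)) → K)),
        IsProjectiveSet K n (m * (2 * ℓ + 1)) h₁ h₂ O) := by
  have hq1 : (1 : ℚ) < q := by exact_mod_cast hq.one_lt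
  have hq0 : (q : ℚ) - 1 ≠ 0 := (sub_pos.2 hq1).ne'
  have hqne : (q : ℚ) ≠ 0 := by positivity
  have hM : (q : ℚ) ^ m - 1 ≠ 0 := (sub_pos.2 (one_lt_pow₀ hq1 (by omega))).ne'
  -- Writing m ℓ = k + 1 removes the truncated subtractions from the exponents.
  obtain ⟨k, hk⟩ : ∃ k, m * ℓ = k + 1 := Nat.exists_eq_succ_of_ne_zero (by positivity)
  have hk' : m * (ℓ + 1) = k + 1 + m := by rw [mul_add, hk, mul_one]
  have hN : m * (2 * ℓ + 1) = 2 * k + 2 + m := by linarith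
  constructor
  · obtain ⟨O, n, h₁, h₂, n', h₁', h₂', hO, -, e₁, e₂, e₃, -⟩ :=
      exists_isProjectiveSet_compl K hK hm hℓ hr
    have f₁ : (n : ℚ) = (((q : ℚ) ^ r - 1) * ((q : ℚ) ^ (m * ℓ) - 1) *
          ((q : ℚ) ^ (m * (ℓ + 1)) - 1)) / (((q : ℚ) - 1) * ((q : ℚ) ^ m - 1))
        + ((q : ℚ) ^ (m * ℓ) - 1) / ((q : ℚ) - 1) := by
      field_simp
      linear_combination e₁
    have f₂ : (h₁ : ℚ) = (((q : ℚ) ^ (m * ℓ - 1) - 1)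
          * ((q : ℚ) ^ (m * (ℓ + 1) + r) - (q : ℚ) ^ (m * (ℓ + 1)) + (q : ℚ) ^ m - (q : ℚ) ^ r))
          / (((q : ℚ) - 1) * ((q : ℚ) ^ m - 1)) := by
      rw [eq_div_iff (mul_ne_zero hq0 hM)]
      apply mul_left_cancel₀ hqne
      rw [hk, hk'] at *
      simp only [Nat.add_sub_cancel, pow_add, pow_one] at *
      -- The factor q - 1 creates the term n (q - 1)(q^m - 1), which `e₁` eliminates.
      linear_combination (q - 1 : ℚ) * e₂ + e₁
    have f₃ : (h₂ : ℚ) = (((q : ℚ) ^ (m * ℓ) - 1)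
          * ((q : ℚ) ^ (m * (ℓ + 1) + r - 1) - (q : ℚ) ^ (m * (ℓ + 1) - 1)
            + (q : ℚ) ^ m - (q : ℚ) ^ r))
          / (((q : ℚ) - 1) * ((q : ℚ) ^ m - 1)) := by
      rw [eq_div_iff (mul_ne_zero hq0 hM)]
      apply mul_left_cancel₀ hqne
      rw [show m * (ℓ + 1) + r - 1 = k + m + r by omega,
        show m * (ℓ + 1) - 1 = k + m by omega]
      rw [hk, hk'] at *
      simp only [pow_add, pow_one] at *
      linear_combination (q - 1 : ℚ) * e₃ + e₁
    refine ⟨n, h₁, h₂, f₁, f₂, f₃, ?_, O, hO⟩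
    rintro rfl rfl
    rw [mul_one] at hk
    subst hk
    simp only [mul_one, pow_one, one_add_one_eq_two] at e₁ e₂ e₃
    refine ⟨?_, ?_, ?_⟩
    · rw [eq_div_iff hq0]
      apply mul_right_cancel₀ hM
      rw [e₁]
      ring
    · rw [eq_div_iff hq0, show 2 * (k + 1) - 1 = 2 * k + 1 by omega]
      apply mul_right_cancel₀ hM
      apply mul_left_cancel₀ hqne
      linear_combination (q - 1 : ℚ) * e₂ + e₁
    · rw [eq_div_iff hq0, show 2 * (k + 1) - 1 = 2 * k + 1 by omega]
      apply mul_right_cancel₀ hM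
      apply mul_left_cancel₀ hqne
      linear_combination (q - 1 : ℚ) * e₃ + e₁
  · obtain ⟨O, n, h₁, h₂, n', h₁', h₂', -, hO, e₁, e₂, e₃, e₄, e₅, e₆⟩ :=
      exists_isProjectiveSet_compl K hK hm hℓ (Nat.sub_le m r)
    -- Here s = m - r is the dimension of R whose complement is used.
    obtain ⟨s, rfl⟩ := Nat.exists_eq_add_of_le hr
    rw [hN] at e₄ e₅ e₆
    rw [Nat.add_sub_cancel_left] at *
    refine ⟨n', h₁', h₂', ?_, ?_, ?_, Oᶜ, hO⟩
    · rw [hk, hk'] at *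
      field_simp
      simp only [pow_add, pow_one, pow_mul] at *
      linear_combination ((q : ℚ) ^ r * q ^ s - 1) * e₄ - e₁
    · rw [eq_div_iff (mul_ne_zero hq0 hM)]
      apply mul_left_cancel₀ hqne
      rw [show (r + s) * (ℓ + 1) - 1 = k + (r + s) by omega,
        show (r + s) * (ℓ + 1) - r = k + 1 + s by omega]
      rw [show 2 * k + 2 + (r + s) - 1 = 2 * k + 1 + (r + s) by omega] at e₅
      rw [hk, hk'] at *
      simp only [pow_add, pow_one, pow_mul] at *
      linear_combination (q : ℚ) * ((q : ℚ) ^ r * q ^ s - 1) * e₅ - (q - 1 : ℚ) * e₃ - e₁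
    · rw [eq_div_iff (mul_ne_zero hq0 hM)]
      apply mul_left_cancel₀ hqne
      rw [show (r + s) * (ℓ + 1) - 1 = k + (r + s) by omega,
        show (r + s) * (ℓ + 1) - r - 1 = k + s by omega]
      rw [show 2 * k + 2 + (r + s) - 1 = 2 * k + 1 + (r + s) by omega] at e₆
      rw [hk, hk'] at *
      simp only [pow_add, pow_one, pow_mul] at *
      linear_combination (q : ℚ) * ((q : ℚ) ^ r * q ^ s - 1) * e₆ - (q - 1 : ℚ) * e₂ - e₁
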